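/- Let $1\le k\le d$ and $\mu\ge 0$. For $S,S'\subseteq\{1,\dots,d\}$ with $|S|=|S'|=k$ put $v_{S,S'}=\mathbf 1_S\mathbf 1_{S'}^T\in\{0,1\}^{d\times d}$. In the isotropic setting one observes a $d\times d$ matrix $y\sim\mathbb P_{S,S'}=\mathcal N(\mu v_{S,S'},I_{d^2})$ and the minimax risk is $$\mathcal R_{d,k}(\mu)=\inf_T\max_{S,S'}\mathbb P_{S,S'}[T(y)\neq(S,S')],$$ the infimum being over all measurable maps $T$ from $\mathbb R^{d\times d}$ to the set of pairs $(S,S')$. With budget $\tau>0$, one chooses $B\in\mathbb R_{\ge 0}^{d\times d}$ with $\sum_{a,b}B(a,b)\le\tau$ and observes, under $\mathbb P_{S,S',B}$, independent entries $y(a,b)\sim\mathcal N(\mu v_{S,S'}(a,b),B(a,b)^{-1})$, where $y(a,b)=0$ almost surely if $B(a,b)=0$; the minimax risk is $$\mathcal R_{d,k}(\mu,\tau)=\inf_{B,T}\max_{S,S'}\mathbb P_{S,S',B}[T(y)\neq(S,S')].$$ 1. (Minimax rates.) Let $(d_n)$, $(k_n)$ be integer sequences with $1\le k_n<d_n$ and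 $d_n\to\infty$, and let $\tau_n>0$ and $\mu_n\ge 0$ be real sequences. (a) The minimax rate is $\mu\asymp\sqrt{\log(k(d-k))/k}$: with $f_n=\sqrt{\log(k_n(d_n-k_n))/k_n}$, if $\mu_n=\omega(f_n)$ then $\mathcal R_{d_n,k_n}(\mu_n)\to 0$, and if $\mu_n=o(f_n)$ then $\mathcal R_{d_n,k_n}(\mu_n)\to 1$. (b) Under budget $\tau$ it is $\mu\asymp\sqrt{\frac{d^2}{\tau k}\log(k(d-k))}$: with $g_n=\sqrt{\frac{d_n^2}{\tau_nk_n}\log(k_n(d_n-k_n))}$, if $\mu_n=\omega(g_n)$ then $\mathcal R_{d_n,k_n}(\mu_n,\tau_n)\to 0$, and if $\mu_n=o(g_n)$ then $\mathcal R_{d_n,k_n}(\mu_n,\tau_n)\to 1$. 2. (Optimality of the MLE.) Let $k\le d$ and $\mu>0$ be fixed. The family $\{\mu v_{S,S'}\}$ is invariant under row and column permutations: applying all pairs of a row and a column permutation to any one member yields exactly the family. In the isotropic setting a maximum likelihood estimator exists, that is, a measurable $T$ such that $T(y)$ maximizes the density of $\mathbb P_{S,S'}$ at $y$ over $(S,S')$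 for every $y$, and every such $T$ is minimax optimal: $\max_{S,S'}\mathbb P_{S,S'}[T(y)\neq(S,S')]=\mathcal R_{d,k}(\mu)$. -/

import Mathlib

open MeasureTheory ProbabilityTheory Filter Asymptotics
open scoped ENNReal NNReal Topology

noncomputable section

namespace NormalMeans

/-- Maximum risk `sup_j P_j[T(y) ≠ j]` of an estimator `T` of the index `j`. -/
def maxRisk {Ω J : Type*} [MeasurableSpace Ω] (P : J → Measure Ω) (T : Ω → J) : ℝ≥0∞ :=
  ⨆ j, P j {y | T y ≠ j}

/-- Minimax risk `inf_T sup_j P_j[T(y) ≠ j]`, the infimum being over the measurable maps into the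
(discrete) set of indices. -/
def minimaxRisk {Ω J : Type*} [MeasurableSpace Ω] (P : J → Measure Ω) : ℝ≥0∞ :=
  ⨅ (T : Ω → J) (_ : Measurable[_, ⊤] T), maxRisk P T

/-- `P_j = N(v_j, I)` on `ℝ^ι`. -/
def isotropicLaw {ι J : Type*} [Fintype ι] (v : J → ι → ℝ) (j : J) : Measure (ι → ℝ) :=
  Measure.pi fun i => gaussianReal (v j i) 1

/-- `P_{j,B}`: independent coordinates `y(i) ~ N(v_j(i), B(i)⁻¹)`, and `y(i) = 0` almost surely
where `B(i) = 0`. -/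
def designLaw {ι J : Type*} [Fintype ι] (v : J → ι → ℝ) (B : ι → ℝ≥0) (j : J) :
    Measure (ι → ℝ) :=
  Measure.pi fun i => if B i = 0 then Measure.dirac 0 else gaussianReal (v j i) (B i)⁻¹

/-- Minimax risk under a budget: the infimum over the sensing strategies `B ≥ 0` with
`‖B‖₁ ≤ τ` and over the estimators. -/
def designMinimaxRisk {ι J : Type*} [Fintype ι] (v : J → ι → ℝ) (τ : ℝ) : ℝ≥0∞ :=
  ⨅ (B : ι → ℝ≥0) (_ : ∑ i, (B i : ℝ) ≤ τ), minimaxRisk (designLaw v B)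

/-- The density of `N(v_j, I)` at `y`. -/
def likelihood {ι J : Type*} [Fintype ι] (v : J → ι → ℝ) (j : J) (y : ι → ℝ) : ℝ :=
  ∏ i, gaussianPDFReal (v j i) 1 (y i)

/-- `T` is a maximum likelihood estimator in the isotropic setting (ties broken in any
measurable way). -/
def IsMLE {ι J : Type*} [Fintype ι] (v : J → ι → ℝ) (T : (ι → ℝ) → J) : Prop :=
  Measurable[_, ⊤] T ∧ ∀ y j, likelihood v j y ≤ likelihood v (T y) y

/-- The minimax rate `μ ≍ f(n)`, where `R n μ` is the minimax risk of the `n`-th problem at signal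
strength `μ`: the risk tends to `0` if `μ = ω(f)`, and to `1` if `μ = o(f)`. -/
def IsMinimaxRate (R : ℕ → ℝ → ℝ≥0∞) (f : ℕ → ℝ) : Prop :=
  ∀ μ : ℕ → ℝ, (∀ n, 0 ≤ μ n) →
    (f =o[atTop] μ → Tendsto (fun n => R n (μ n)) atTop (𝓝 0)) ∧
    (μ =o[atTop] f → Tendsto (fun n => R n (μ n)) atTop (𝓝 1))

/-- The subsets of `{1, …, d}` of size `k`. -/
abbrev KSet (d k : ℕ) : Type := {S : Finset (Fin d) // S.card = k}

/-- The `k × k` biclusters in `d × d` matrices at signal strength `μ`: the matrices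
`μ 1_S 1_{S'}ᵀ` with `|S| = |S'| = k`. -/
def bicluster (d k : ℕ) (μ : ℝ) (j : KSet d k × KSet d k) : Fin d × Fin d → ℝ :=
  fun p => if p.1 ∈ j.1.1 ∧ p.2 ∈ j.2.1 then μ else 0

end NormalMeans

end

/-!
The Gaussian law with mean `u` and precisions `B` has density `exp ℓ` with respect to the one with
mean `w`, and `𝔼_w [exp (s ℓ)] = exp (s (s - 1) D / 2)`, where
`D = ∑ i, B i (u i - w i) ^ 2`. Everything quantitative comes from two values of `s`.

For the upper bound, spread the budget uniformly and take `s = 1 / 2`: the likelihood of a wrong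
bicluster beats that of the true one with probability at most `exp (-D / 8)`. If `p` rows and `q`
columns are wrong, then `D` is at least proportional to `k (p + q)`, and summing over all wrong
biclusters gives a risk that vanishes as soon as `k (d - k) exp (-c k μ²)` does.

For the lower bound, take `s = 2`: by Cauchy–Schwarz, an estimator cannot tell apart `m`
alternatives whose distance `D` to a common reference is small compared with `log m`. For any
budget, averaging produces `k` columns on which most rows carry little budget, and then changing a
single row of a fixed set gives at least `d / 4` alternatives that are all close to that set.

Likelihood maximization minimizes the average risk over the uniform prior. Row and column
permutations act transitively on the biclusters, and ties of likelihoods have probability zero, so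
the risk of a maximum likelihood estimator is constant. Its maximum risk is thus its average risk,
which bounds every other maximum risk from below.
-/

namespace NormalMeans

section Product

variable {ι : Type*} [Fintype ι]

theorem lintegral_fin_nat_prod_eq_prod {n : ℕ} {E : Fin n → Type*}
    {mE : ∀ i, MeasurableSpace (E i)} {ν : ∀ i, Measure (E i)} [∀ i, SigmaFinite (ν i)]
    {f : ∀ i, E i → ℝ≥0∞} (hf : ∀ i, Measurable (f i)) :
    ∫⁻ y, ∏ i, f i (y i) ∂Measure.pi ν = ∏ i, ∫⁻ x, f i x ∂ν i := by
  induction n with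
  | zero => simp
  | succ n ih =>
    have htail : Measurable fun z : ∀ i : Fin n, E (Fin.succAbove 0 i) =>
        ∏ i, f (Fin.succAbove 0 i) (z i) :=
      Finset.measurable_prod _ fun i _ => (hf _).comp (measurable_pi_apply i)
    rw [← ((measurePreserving_piFinSuccAbove ν 0).symm).lintegral_comp_emb
      (MeasurableEquiv.measurableEmbedding _)]
    simp_rw [Fin.prod_univ_succAbove _ 0, MeasurableEquiv.piFinSuccAbove_symm_apply,
      Fin.insertNthEquiv_apply, Fin.insertNth_apply_same, Fin.insertNth_apply_succAbove]
    rw [lintegral_prod_mul (hf 0).aemeasurable htail.aemeasurable, ih fun i => hf _]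

variable {E : ι → Type*} {mE : ∀ i, MeasurableSpace (E i)} {ν : ∀ i, Measure (E i)}
  [∀ i, SigmaFinite (ν i)] {f : ∀ i, E i → ℝ≥0∞}

theorem lintegral_fintype_prod_eq_prod (hf : ∀ i, Measurable (f i)) :
    ∫⁻ y, ∏ i, f i (y i) ∂Measure.pi ν = ∏ i, ∫⁻ x, f i x ∂ν i := by
  let e := (Fintype.equivFin ι).symm
  rw [← (measurePreserving_piCongrLeft ν e).lintegral_comp_emb
    (MeasurableEquiv.measurableEmbedding _)]
  simp_rw [← e.prod_comp, MeasurableEquiv.coe_piCongrLeft, Equiv.piCongrLeft_apply_apply]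
  exact lintegral_fin_nat_prod_eq_prod fun i => hf (e i)

theorem pi_withDensity [∀ i, SigmaFinite ((ν i).withDensity (f i))]
    (hf : ∀ i, Measurable (f i)) :
    Measure.pi (fun i => (ν i).withDensity (f i)) =
      (Measure.pi ν).withDensity fun y => ∏ i, f i (y i) := by
  refine Measure.pi_eq fun s hs => ?_
  have hind (y : ∀ i, E i) : (Set.univ.pi s).indicator (fun y => ∏ i, f i (y i)) y =
      ∏ i, (s i).indicator (f i) (y i) := by
    classical
    simp only [Set.indicator_apply, Set.mem_univ_pi, Finset.prod_ite_zero, Finset.mem_univ,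
      true_imp_iff]
  calc (Measure.pi ν).withDensity (fun y => ∏ i, f i (y i)) (Set.univ.pi s)
      = ∫⁻ y, ∏ i, (s i).indicator (f i) (y i) ∂Measure.pi ν := by
        rw [withDensity_apply _ (.univ_pi hs), ← lintegral_indicator (.univ_pi hs)]
        simp_rw [hind]
    _ = ∏ i, (ν i).withDensity (f i) (s i) := by
        simp_rw [lintegral_fintype_prod_eq_prod fun i => (hf i).indicator (hs i),
          lintegral_indicator (hs _), withDensity_apply _ (hs _)]

end Product

section GaussianRatio

/-- The Gaussian law with mean `m` and precision `b`, with the convention of `designLaw` that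
zero precision gives the unit mass at `0`. -/
noncomputable def precisionGaussian (m : ℝ) (b : ℝ≥0) : Measure ℝ :=
  if b = 0 then Measure.dirac 0 else gaussianReal m b⁻¹

instance (m : ℝ) (b : ℝ≥0) : IsProbabilityMeasure (precisionGaussian m b) := by
  unfold precisionGaussian
  split_ifs <;> infer_instance

/-- The log-likelihood ratio, at `x`, of Gaussian laws of precision `b` and means `m` and `w`. -/
noncomputable def gaussianLogRatio (b : ℝ≥0) (m w x : ℝ) : ℝ :=
  b * ((m - w) * x - (m ^ 2 - w ^ 2) / 2)

@[fun_prop]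
theorem measurable_gaussianLogRatio (b : ℝ≥0) (m w : ℝ) :
    Measurable (gaussianLogRatio b m w) := by
  unfold gaussianLogRatio
  fun_prop

theorem gaussianPDFReal_eq_mul_exp_gaussianLogRatio {b : ℝ≥0} (hb : b ≠ 0) (m w x : ℝ) :
    gaussianPDFReal m b⁻¹ x = gaussianPDFReal w b⁻¹ x * Real.exp (gaussianLogRatio b m w x) := by
  have hb' : (b : ℝ) ≠ 0 := by exact_mod_cast hb
  rw [gaussianPDFReal, gaussianPDFReal, gaussianLogRatio, mul_assoc (√_)⁻¹, ← Real.exp_add]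
  congr 2
  push_cast
  field_simp
  ring

theorem precisionGaussian_eq_withDensity (b : ℝ≥0) (m w : ℝ) :
    precisionGaussian m b = (precisionGaussian w b).withDensity
      fun x => ENNReal.ofReal (Real.exp (gaussianLogRatio b m w x)) := by
  rcases eq_or_ne b 0 with rfl | hb
  · simp [precisionGaussian, gaussianLogRatio]
  · rw [precisionGaussian, precisionGaussian, if_neg hb, if_neg hb,
      gaussianReal_of_var_ne_zero m (inv_ne_zero hb),
      gaussianReal_of_var_ne_zero w (inv_ne_zero hb),
      ← withDensity_mul _ (measurable_gaussianPDF _ _) (by fun_prop)]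
    congr 1 with x
    rw [Pi.mul_apply, gaussianPDF, gaussianPDF, gaussianPDFReal_eq_mul_exp_gaussianLogRatio hb m w,
      ENNReal.ofReal_mul (gaussianPDFReal_nonneg _ _ _)]

theorem lintegral_exp_mul_gaussianLogRatio (b : ℝ≥0) (m w s : ℝ) :
    ∫⁻ x, ENNReal.ofReal (Real.exp (s * gaussianLogRatio b m w x)) ∂precisionGaussian w b =
      ENNReal.ofReal (Real.exp (s * (s - 1) / 2 * (b * (m - w) ^ 2))) := by
  rcases eq_or_ne b 0 with rfl | hb
  · simp [gaussianLogRatio]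
  have hb' : (b : ℝ) ≠ 0 := by exact_mod_cast hb
  set t := s * b * (m - w) with ht
  set c := -(s * b * (m ^ 2 - w ^ 2) / 2) with hc
  have hmgf : ∫ x, Real.exp (t * x) ∂gaussianReal w b⁻¹ =
      Real.exp (w * t + (b⁻¹ : ℝ≥0) * t ^ 2 / 2) :=
    congrFun (mgf_id_gaussianReal (μ := w) (v := b⁻¹)) t
  calc ∫⁻ x, ENNReal.ofReal (Real.exp (s * gaussianLogRatio b m w x)) ∂precisionGaussian w b
      = ∫⁻ x, ENNReal.ofReal (Real.exp (t * x) * Real.exp c) ∂gaussianReal w b⁻¹ := by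
        rw [precisionGaussian, if_neg hb]
        refine lintegral_congr fun x => ?_
        rw [← Real.exp_add, gaussianLogRatio, ht, hc]
        ring_nf
    _ = ENNReal.ofReal (Real.exp (w * t + (b⁻¹ : ℝ≥0) * t ^ 2 / 2) * Real.exp c) := by
        rw [← hmgf, ← integral_mul_const, ofReal_integral_eq_lintegral_ofReal
          ((integrable_exp_mul_gaussianReal t).mul_const _) (ae_of_all _ fun x => by positivity)]
    _ = ENNReal.ofReal (Real.exp (s * (s - 1) / 2 * (b * (m - w) ^ 2))) := by
        rw [← Real.exp_add, ht, hc]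
        congr 2
        push_cast
        field_simp
        ring

variable {ι J : Type*} [Fintype ι]

/-- The law of independent Gaussian coordinates with means `m i` and precisions `B i`. -/
noncomputable def productGaussian (B : ι → ℝ≥0) (m : ι → ℝ) : Measure (ι → ℝ) :=
  Measure.pi fun i => precisionGaussian (m i) (B i)

instance (B : ι → ℝ≥0) (m : ι → ℝ) : IsProbabilityMeasure (productGaussian B m) := by
  unfold productGaussian
  infer_instance

/-- The log-likelihood ratio, at `y`, of `productGaussian B u` and `productGaussian B w`. -/
noncomputable def logLikelihoodRatio (B : ι → ℝ≥0) (u w y : ι → ℝ) : ℝ :=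
  ∑ i, gaussianLogRatio (B i) (u i) (w i) (y i)

/-- The squared distance of `u` and `w` in the Euclidean norm weighted by the precisions `B`. -/
noncomputable def weightedSqDist (B : ι → ℝ≥0) (u w : ι → ℝ) : ℝ :=
  ∑ i, B i * (u i - w i) ^ 2

@[fun_prop]
theorem measurable_logLikelihoodRatio (B : ι → ℝ≥0) (u w : ι → ℝ) :
    Measurable (logLikelihoodRatio B u w) := by
  unfold logLikelihoodRatio
  fun_prop

theorem logLikelihoodRatio_sub_logLikelihoodRatio (B : ι → ℝ≥0) (u u' w y : ι → ℝ) :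
    logLikelihoodRatio B u w y - logLikelihoodRatio B u' w y = logLikelihoodRatio B u u' y := by
  simp only [logLikelihoodRatio, gaussianLogRatio, ← Finset.sum_sub_distrib]
  exact Finset.sum_congr rfl fun i _ => by ring

theorem productGaussian_eq_withDensity (B : ι → ℝ≥0) (u w : ι → ℝ) :
    productGaussian B u = (productGaussian B w).withDensity
      fun y => ENNReal.ofReal (Real.exp (logLikelihoodRatio B u w y)) := by
  have h i := precisionGaussian_eq_withDensity (B i) (u i) (w i)
  have (i : ι) : SigmaFinite ((precisionGaussian (w i) (B i)).withDensity
      fun x => ENNReal.ofReal (Real.exp (gaussianLogRatio (B i) (u i) (w i) x))) := by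
    rw [← h i]
    infer_instance
  rw [productGaussian, funext h, pi_withDensity fun i => by fun_prop, productGaussian]
  congr 1 with y
  rw [logLikelihoodRatio, Real.exp_sum,
    ENNReal.ofReal_prod_of_nonneg fun i _ => (Real.exp_pos _).le]

theorem lintegral_exp_mul_logLikelihoodRatio (B : ι → ℝ≥0) (u w : ι → ℝ) (s : ℝ) :
    ∫⁻ y, ENNReal.ofReal (Real.exp (s * logLikelihoodRatio B u w y)) ∂productGaussian B w =
      ENNReal.ofReal (Real.exp (s * (s - 1) / 2 * weightedSqDist B u w)) := by
  simp_rw [logLikelihoodRatio, weightedSqDist, Finset.mul_sum, Real.exp_sum,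
    ENNReal.ofReal_prod_of_nonneg fun _ _ => (Real.exp_pos _).le]
  rw [productGaussian, lintegral_fintype_prod_eq_prod (f := fun i x =>
    ENNReal.ofReal (Real.exp (s * gaussianLogRatio (B i) (u i) (w i) x))) fun i => by fun_prop]
  exact Finset.prod_congr rfl fun i _ => lintegral_exp_mul_gaussianLogRatio _ _ _ _

theorem designLaw_eq_productGaussian (v : J → ι → ℝ) (B : ι → ℝ≥0) (j : J) :
    designLaw v B j = productGaussian B (v j) := rfl

theorem isotropicLaw_eq_designLaw (v : J → ι → ℝ) : isotropicLaw v = designLaw v fun _ => 1 := by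
  ext1 j
  simp [isotropicLaw, designLaw]

instance (v : J → ι → ℝ) (B : ι → ℝ≥0) (j : J) : IsProbabilityMeasure (designLaw v B j) :=
  inferInstanceAs (IsProbabilityMeasure (productGaussian B (v j)))

instance (v : J → ι → ℝ) (j : J) : IsProbabilityMeasure (isotropicLaw v j) := by
  unfold isotropicLaw
  infer_instance

end GaussianRatio

section DecisionTheory

variable {Ω J : Type*} [MeasurableSpace Ω] {T : Ω → J}

theorem measurableSet_fiber (hT : Measurable[_, ⊤] T) (j : J) : MeasurableSet {y | T y = j} :=
  hT (t := {j}) trivial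

theorem measurable_selection [Countable J] {X : Type*} [MeasurableSpace X] {f : J → Ω → X}
    (hf : ∀ j, Measurable (f j)) (hT : Measurable[_, ⊤] T) : Measurable fun y => f (T y) y := by
  let _ : MeasurableSpace J := ⊤
  exact (measurable_from_prod_countable_left (f := fun p : Ω × J => f p.2 p.1) hf).comp
    (measurable_id.prodMk hT)

theorem exists_measurable_argmax [Finite J] [Nonempty J] {f : J → Ω → ℝ}
    (hf : ∀ j, Measurable (f j)) :
    ∃ T : Ω → J, Measurable[_, ⊤] T ∧ ∀ y j, f j y ≤ f (T y) y := by
  classical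
  have := Fintype.ofFinite J
  let _ : MeasurableSpace J := ⊤
  suffices ∀ s : Finset J, ∃ T : Ω → J, Measurable T ∧ ∀ y, ∀ j ∈ s, f j y ≤ f (T y) y by
    simpa using this Finset.univ
  intro s
  induction s using Finset.induction_on with
  | empty => exact ⟨fun _ => Classical.arbitrary J, measurable_const, by simp⟩
  | insert a s _ ih =>
    obtain ⟨T, hT, hmax⟩ := ih
    refine ⟨fun y => if f a y ≤ f (T y) y then T y else a, Measurable.ite
      (measurableSet_le (hf a) (measurable_selection hf hT)) hT measurable_const, fun y j hj => ?_⟩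
    dsimp only
    split_ifs with h <;> rcases Finset.mem_insert.1 hj with rfl | hj
    exacts [h, hmax y j hj, le_rfl, (hmax y j hj).trans (not_le.1 h).le]

section Risk

variable {P : J → Measure Ω}

theorem error_le_maxRisk (P : J → Measure Ω) (T : Ω → J) (j : J) :
    P j {y | T y ≠ j} ≤ maxRisk P T :=
  le_iSup (fun j => P j {y | T y ≠ j}) j

theorem minimaxRisk_le_maxRisk (P : J → Measure Ω) (hT : Measurable[_, ⊤] T) :
    minimaxRisk P ≤ maxRisk P T :=
  iInf₂_le T hT

theorem minimaxRisk_le_one [Nonempty J] (P : J → Measure Ω) [∀ j, IsProbabilityMeasure (P j)] :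
    minimaxRisk P ≤ 1 :=
  (minimaxRisk_le_maxRisk P (@measurable_const _ _ ⊤ _ (Classical.arbitrary J))).trans
    (iSup_le fun _ => prob_le_one)

theorem minimaxRisk_comp_le {A : Type*} [Nonempty A] {F : A → J} (hF : F.Injective)
    (P : J → Measure Ω) : minimaxRisk (P ∘ F) ≤ minimaxRisk P := by
  refine le_iInf₂ fun T hT => ?_
  have hG : Measurable[_, ⊤] (F.invFun ∘ T) := @measurable_from_top _ _ ⊤ _ |>.comp hT
  refine (minimaxRisk_le_maxRisk _ hG).trans (iSup_le fun a => ?_)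
  calc P (F a) {y | F.invFun (T y) ≠ a} ≤ P (F a) {y | T y ≠ F a} :=
        measure_mono fun y hy hTy => hy (by rw [hTy, F.leftInverse_invFun hF])
    _ ≤ maxRisk P T := error_le_maxRisk P T (F a)

variable [Fintype J]

theorem sum_error_le_card_mul_maxRisk (P : J → Measure Ω) (T : Ω → J) :
    ∑ j, P j {y | T y ≠ j} ≤ Fintype.card J * maxRisk P T := by
  simpa using Finset.sum_le_card_nsmul Finset.univ _ _ fun j _ => error_le_maxRisk P T j

theorem sum_success_add_sum_error (P : J → Measure Ω) [∀ j, IsProbabilityMeasure (P j)]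
    (hT : Measurable[_, ⊤] T) :
    ∑ j, P j {y | T y = j} + ∑ j, P j {y | T y ≠ j} = Fintype.card J := by
  have h j : P j {y | T y = j} + P j {y | T y ≠ j} = 1 := by
    exact (measure_add_measure_compl (measurableSet_fiber hT j)).trans measure_univ
  rw [← Finset.sum_add_distrib]
  simp only [h, Finset.sum_const, Finset.card_univ, nsmul_eq_mul, mul_one]

theorem maxRisk_eq_minimaxRisk_of_forall_error_eq [Nonempty J] (hT : Measurable[_, ⊤] T)
    (hconst : ∀ j j', P j {y | T y ≠ j} = P j' {y | T y ≠ j'})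
    (hmin : ∀ T' : Ω → J, Measurable[_, ⊤] T' →
      ∑ j, P j {y | T y ≠ j} ≤ ∑ j, P j {y | T' y ≠ j}) :
    maxRisk P T = minimaxRisk P := by
  refine le_antisymm (le_iInf₂ fun T' hT' => iSup_le fun j => ?_) (minimaxRisk_le_maxRisk P hT)
  refine (ENNReal.mul_le_mul_iff_right (a := (Fintype.card J : ℝ≥0∞)) (by simp)
    (ENNReal.natCast_ne_top _)).1 ?_
  calc Fintype.card J * P j {y | T y ≠ j} = ∑ j', P j' {y | T y ≠ j'} := by
        simp [fun j' => hconst j' j]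
    _ ≤ ∑ j', P j' {y | T' y ≠ j'} := hmin T' hT'
    _ ≤ Fintype.card J * maxRisk P T' := sum_error_le_card_mul_maxRisk P T'

variable {Q : Measure Ω} {f : J → Ω → ℝ≥0∞}

theorem sum_success_eq_lintegral (hT : Measurable[_, ⊤] T)
    (hP : ∀ j, P j = Q.withDensity (f j)) :
    ∑ j, P j {y | T y = j} = ∫⁻ y, f (T y) y ∂Q := by
  have hdisj : Pairwise (Function.onFun Disjoint fun j => {y | T y = j}) := fun i j hij =>
    Set.disjoint_left.2 fun y hi hj => hij (hi.symm.trans hj)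
  have hcover : ⋃ j, {y | T y = j} = Set.univ := by ext; simp
  rw [← setLIntegral_univ, ← hcover, lintegral_iUnion (measurableSet_fiber hT) hdisj, tsum_fintype]
  refine Finset.sum_congr rfl fun j _ => ?_
  rw [hP j, withDensity_apply _ (measurableSet_fiber hT j)]
  exact setLIntegral_congr_fun (measurableSet_fiber hT j) fun y hy => by
    rw [show T y = j from hy]

theorem sum_error_le_of_forall_density_le [∀ j, IsProbabilityMeasure (P j)]
    (hP : ∀ j, P j = Q.withDensity (f j)) (hT : Measurable[_, ⊤] T)
    (hmax : ∀ y j, f j y ≤ f (T y) y) {T' : Ω → J} (hT' : Measurable[_, ⊤] T') :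
    ∑ j, P j {y | T y ≠ j} ≤ ∑ j, P j {y | T' y ≠ j} := by
  have hsuccess : ∑ j, P j {y | T' y = j} ≤ ∑ j, P j {y | T y = j} := by
    rw [sum_success_eq_lintegral hT' hP, sum_success_eq_lintegral hT hP]
    exact lintegral_mono fun y => hmax y (T' y)
  have hfin : ∑ j, P j {y | T y = j} ≠ ∞ := ENNReal.sum_ne_top.2 fun j _ => measure_ne_top _ _
  refine (ENNReal.add_le_add_iff_left hfin).1 ?_
  rw [sum_success_add_sum_error P hT, ← sum_success_add_sum_error P hT']
  gcongr

theorem sq_lintegral_le_lintegral_sq [IsProbabilityMeasure Q] {g : Ω → ℝ≥0∞} (hg : Measurable g) :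
    (∫⁻ y, g y ∂Q) ^ 2 ≤ ∫⁻ y, g y ^ 2 ∂Q := by
  have h := eLpNorm'_le_eLpNorm'_of_exponent_le one_pos one_le_two Q hg.aestronglyMeasurable
  simp only [eLpNorm', enorm_eq_self, ENNReal.rpow_one, ENNReal.rpow_ofNat, ne_eq, one_ne_zero,
    not_false_eq_true, div_self] at h
  calc (∫⁻ y, g y ∂Q) ^ 2 ≤ ((∫⁻ y, g y ^ 2 ∂Q) ^ (1 / 2 : ℝ)) ^ 2 := by gcongr
    _ = ∫⁻ y, g y ^ 2 ∂Q := by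
      rw [← ENNReal.rpow_natCast, ← ENNReal.rpow_mul]
      norm_num

theorem one_sub_le_minimaxRisk_of_lintegral_sq_le [Nonempty J] [∀ j, IsProbabilityMeasure (P j)]
    [IsProbabilityMeasure Q] (hf : ∀ j, Measurable (f j)) (hP : ∀ j, P j = Q.withDensity (f j))
    {c : ℝ≥0∞} (hc : ∀ j, ∫⁻ y, f j y ^ 2 ∂Q ≤ Fintype.card J * c ^ 2) :
    1 - c ≤ minimaxRisk P := by
  refine le_iInf₂ fun T hT => tsub_le_iff_left.2 ?_
  have hsuccess : ∑ j, P j {y | T y = j} ≤ Fintype.card J * c := by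
    rw [sum_success_eq_lintegral hT hP, ← ENNReal.pow_le_pow_left_iff two_ne_zero]
    calc (∫⁻ y, f (T y) y ∂Q) ^ 2 ≤ ∫⁻ y, f (T y) y ^ 2 ∂Q :=
          sq_lintegral_le_lintegral_sq (measurable_selection hf hT)
      _ ≤ ∫⁻ y, ∑ j, f j y ^ 2 ∂Q :=
          lintegral_mono fun y =>
            Finset.single_le_sum_of_canonicallyOrdered (f := fun j => f j y ^ 2)
              (Finset.mem_univ (T y))
      _ = ∑ j, ∫⁻ y, f j y ^ 2 ∂Q := lintegral_finsetSum _ fun j _ => (hf j).pow_const 2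
      _ ≤ (Fintype.card J * c) ^ 2 := by
          refine (Finset.sum_le_card_nsmul _ _ _ fun j _ => hc j).trans_eq ?_
          rw [Finset.card_univ, nsmul_eq_mul]
          ring
  refine (ENNReal.mul_le_mul_iff_right (a := (Fintype.card J : ℝ≥0∞)) (by simp)
    (ENNReal.natCast_ne_top _)).1 ?_
  calc (Fintype.card J : ℝ≥0∞) * 1 = ∑ j, P j {y | T y = j} + ∑ j, P j {y | T y ≠ j} := by
        rw [mul_one, sum_success_add_sum_error P hT]
    _ ≤ Fintype.card J * c + Fintype.card J * maxRisk P T :=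
        add_le_add hsuccess (sum_error_le_card_mul_maxRisk P T)
    _ = Fintype.card J * (c + maxRisk P T) := (mul_add _ _ _).symm

end Risk

end DecisionTheory

section MaximumLikelihood

theorem addHaar_setOf_linearMap_eq {E : Type*} [NormedAddCommGroup E] [NormedSpace ℝ E]
    [MeasurableSpace E] [BorelSpace E] [FiniteDimensional ℝ E] (ν : Measure E) [ν.IsAddHaarMeasure]
    {L : E →ₗ[ℝ] ℝ} (hL : L ≠ 0) (c : ℝ) : ν {x | L x = c} = 0 := by
  have hcoe : ((affineSpan ℝ {c}).comap L.toAffineMap : Set E) = {x | L x = c} := by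
    ext x
    simp
  rw [← hcoe]
  refine Measure.addHaar_affineSubspace ν _ fun htop => hL (LinearMap.ext fun x => ?_)
  have hconst (x : E) : L x = c := by
    change x ∈ {x | L x = c}
    rw [← hcoe, htop]
    trivial
  rw [hconst x, ← hconst 0, map_zero, LinearMap.zero_apply]

variable {ι J : Type*} [Fintype ι] {v : J → ι → ℝ} {T : (ι → ℝ) → J}

@[fun_prop]
theorem measurable_likelihood (v : J → ι → ℝ) (j : J) : Measurable (likelihood v j) :=
  Finset.measurable_prod _ fun i _ =>
    (measurable_gaussianPDFReal _ _).comp (measurable_pi_apply i)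

theorem likelihood_pos (v : J → ι → ℝ) (j : J) (y : ι → ℝ) : 0 < likelihood v j y :=
  Finset.prod_pos fun _ _ => gaussianPDFReal_pos _ _ _ one_ne_zero

theorem isotropicLaw_eq_withDensity (v : J → ι → ℝ) (j : J) :
    isotropicLaw v j = volume.withDensity fun y => ENNReal.ofReal (likelihood v j y) := by
  have h i := gaussianReal_of_var_ne_zero (v j i) one_ne_zero
  have (i : ι) : SigmaFinite (volume.withDensity (gaussianPDF (v j i) 1)) := by
    rw [← h i]
    infer_instance
  rw [isotropicLaw, funext h, pi_withDensity fun i => measurable_gaussianPDF _ _, volume_pi]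
  congr 1 with y
  exact (ENNReal.ofReal_prod_of_nonneg fun i _ => gaussianPDFReal_nonneg _ _ _).symm

theorem likelihood_eq_mul_exp_logLikelihoodRatio (v : J → ι → ℝ) (j j' : J) (y : ι → ℝ) :
    likelihood v j y =
      likelihood v j' y * Real.exp (logLikelihoodRatio (fun _ => 1) (v j) (v j') y) := by
  rw [likelihood, likelihood, logLikelihoodRatio, Real.exp_sum, ← Finset.prod_mul_distrib]
  refine Finset.prod_congr rfl fun i _ => ?_
  simpa only [inv_one] using
    gaussianPDFReal_eq_mul_exp_gaussianLogRatio one_ne_zero (v j i) (v j' i) (y i)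

theorem volume_setOf_likelihood_eq {j j' : J} (h : v j ≠ v j') :
    volume {y | likelihood v j y = likelihood v j' y} = 0 := by
  obtain ⟨i, hi⟩ := Function.ne_iff.1 (sub_ne_zero.2 h)
  let L : (ι → ℝ) →ₗ[ℝ] ℝ := ∑ i, (v j - v j') i • LinearMap.proj i
  have hL : L ≠ 0 := fun hL => hi (by
    classical
    simpa [L, Pi.single_apply] using LinearMap.congr_fun hL (Pi.single i 1))
  refine measure_mono_null (fun y hy => ?_)
    (addHaar_setOf_linearMap_eq volume hL (∑ i, (v j i ^ 2 - v j' i ^ 2) / 2))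
  have hzero : logLikelihoodRatio (fun _ => 1) (v j) (v j') y = 0 := by
    rw [← Real.exp_eq_one_iff, ← mul_eq_left₀ (likelihood_pos v j' y).ne',
      ← likelihood_eq_mul_exp_logLikelihoodRatio]
    exact hy
  refine sub_eq_zero.1 (Eq.trans ?_ hzero)
  simp [L, logLikelihoodRatio, gaussianLogRatio, Finset.sum_sub_distrib]

/-- The event that an index other than `j` is at least as likely as `j`: up to ties, the error
event of any maximum likelihood estimator, but free of its tie-breaking rule. -/
def rivalEvent (v : J → ι → ℝ) (j : J) : Set (ι → ℝ) :=
  {y | ∃ j', j' ≠ j ∧ likelihood v j y ≤ likelihood v j' y}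

theorem measurableSet_rivalEvent [Countable J] (v : J → ι → ℝ) (j : J) :
    MeasurableSet (rivalEvent v j) := by
  simp only [rivalEvent, Set.ofPred_exists, Set.ofPred_and]
  exact .iUnion fun j' => .inter (.const _) <|
    measurableSet_le (measurable_likelihood v j) (measurable_likelihood v j')

theorem isotropicLaw_error_eq_rivalEvent [Countable J] (hv : v.Injective) (hT : IsMLE v T) (j : J) :
    isotropicLaw v j {y | T y ≠ j} = isotropicLaw v j (rivalEvent v j) := by
  refine le_antisymm (measure_mono fun y hy => ⟨T y, hy, hT.2 y j⟩) (measure_mono_ae ?_)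
  have hties : ∀ᵐ y ∂isotropicLaw v j, ∀ j' ≠ j, likelihood v j y ≠ likelihood v j' y := by
    rw [isotropicLaw_eq_withDensity]
    refine (withDensity_absolutelyContinuous _ _).ae_le (ae_all_iff.2 fun j' => ?_)
    by_cases hj : j' = j
    · simp [hj]
    · simpa [ae_iff, hj] using volume_setOf_likelihood_eq (hv.ne (Ne.symm hj))
  filter_upwards [hties] with y hy ⟨j', hne, hle⟩ hTy
  exact hy j' hne (hle.antisymm (hTy ▸ hT.2 y j'))

theorem measurePreserving_comp_perm_isotropicLaw (e : Equiv.Perm ι) {j j' : J}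
    (h : v j' = v j ∘ e) :
    MeasurePreserving (fun y => y ∘ e) (isotropicLaw v j) (isotropicLaw v j') := by
  have hpi := measurePreserving_piCongrLeft (fun i => gaussianReal (v j' i) 1) e.symm
  simp only [h, Function.comp_apply, Equiv.apply_symm_apply] at hpi
  simp only [isotropicLaw, h, Function.comp_apply]
  convert! hpi using 2 with y
  ext i
  obtain ⟨i, rfl⟩ := e.symm.surjective i
  rw [MeasurableEquiv.coe_piCongrLeft, Equiv.piCongrLeft_apply_apply, Function.comp_apply,
    e.apply_symm_apply]

theorem likelihood_comp_perm (e : Equiv.Perm ι) {j j' : J} (h : v j' = v j ∘ e) (y : ι → ℝ) :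
    likelihood v j' (y ∘ e) = likelihood v j y := by
  simp only [likelihood, h, Function.comp_apply]
  exact Equiv.prod_comp e fun i => gaussianPDFReal (v j i) 1 (y i)

theorem isotropicLaw_rivalEvent_perm [Countable J] (e : Equiv.Perm ι) (σ : Equiv.Perm J)
    (h : ∀ j, v (σ j) = v j ∘ e) (j : J) :
    isotropicLaw v (σ j) (rivalEvent v (σ j)) = isotropicLaw v j (rivalEvent v j) := by
  rw [← (measurePreserving_comp_perm_isotropicLaw e (h j)).measure_preimage
    (measurableSet_rivalEvent v _).nullMeasurableSet]
  congr 1 with y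
  refine (σ.exists_congr fun j' => ?_).symm
  rw [σ.injective.ne_iff, likelihood_comp_perm e (h j), likelihood_comp_perm e (h j')]

theorem IsMLE.maxRisk_eq_minimaxRisk [Finite J] [Nonempty J] (hT : IsMLE v T) (hv : v.Injective)
    (hsymm : ∀ j₁ j₂, ∃ (e : Equiv.Perm ι) (σ : Equiv.Perm J),
      (∀ j, v (σ j) = v j ∘ e) ∧ σ j₁ = j₂) :
    maxRisk (isotropicLaw v) T = minimaxRisk (isotropicLaw v) := by
  have := Fintype.ofFinite J
  refine maxRisk_eq_minimaxRisk_of_forall_error_eq hT.1 (fun j₁ j₂ => ?_) fun T' hT' =>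
    sum_error_le_of_forall_density_le (isotropicLaw_eq_withDensity v) hT.1
      (fun y j => ENNReal.ofReal_le_ofReal (hT.2 y j)) hT'
  obtain ⟨e, σ, hσ, rfl⟩ := hsymm j₁ j₂
  rw [isotropicLaw_error_eq_rivalEvent hv hT, isotropicLaw_error_eq_rivalEvent hv hT,
    isotropicLaw_rivalEvent_perm e σ hσ]

theorem exists_isMLE [Finite J] [Nonempty J] (v : J → ι → ℝ) : ∃ T, IsMLE v T :=
  exists_measurable_argmax (measurable_likelihood v)

end MaximumLikelihood

section Symmetry

variable {d k : ℕ} {μ : ℝ}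

theorem nonempty_kset (h : k ≤ d) : Nonempty (KSet d k) := by
  obtain ⟨S, -, hS⟩ := Finset.exists_subset_card_eq (s := (Finset.univ : Finset (Fin d))) (n := k)
    (by simpa using h)
  exact ⟨⟨S, hS⟩⟩

/-- The action of a permutation of `{1, …, d}` on the subsets of size `k`. -/
def ksetPerm (g : Equiv.Perm (Fin d)) : Equiv.Perm (KSet d k) :=
  (Equiv.finsetCongr g).subtypeEquiv fun S => by simp

theorem mem_ksetPerm (g : Equiv.Perm (Fin d)) (S : KSet d k) (a : Fin d) :
    a ∈ (ksetPerm g S).1 ↔ g.symm a ∈ S.1 := by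
  simp [ksetPerm, Finset.mem_map_equiv]

theorem exists_ksetPerm_eq (S S' : KSet d k) : ∃ g : Equiv.Perm (Fin d), ksetPerm g S = S' := by
  let e : {a // a ∈ S.1} ≃ {a // a ∈ S'.1} := Finset.equivOfCardEq (S.2.trans S'.2.symm)
  refine ⟨e.extendSubtype, Subtype.ext (Finset.eq_of_subset_of_card_le (fun a ha => ?_) ?_)⟩
  · rw [mem_ksetPerm] at ha
    simpa using e.extendSubtype_mem _ ha
  · rw [S'.2, (ksetPerm _ S).2]

theorem bicluster_ksetPerm (μ : ℝ) (g g' : Equiv.Perm (Fin d)) (j : KSet d k × KSet d k) :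
    bicluster d k μ (ksetPerm g j.1, ksetPerm g' j.2) =
      bicluster d k μ j ∘ Equiv.prodCongr g.symm g'.symm := by
  ext p
  simp [bicluster, mem_ksetPerm]

theorem bicluster_injective (hμ : μ ≠ 0) : (bicluster d k μ).Injective := by
  rintro ⟨S, S'⟩ ⟨T, T'⟩ h
  rcases Nat.eq_zero_or_pos k with rfl | hk
  · have (U V : KSet d 0) : U = V :=
      Subtype.ext ((Finset.card_eq_zero.1 U.2).trans (Finset.card_eq_zero.1 V.2).symm)
    rw [this S T, this S' T']
  have hprod : (S.1 : Set (Fin d)) ×ˢ (S'.1 : Set (Fin d)) = (T.1 : Set _) ×ˢ (T'.1 : Set _) := by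
    ext p
    have hp := congrFun h p
    simp only [bicluster] at hp
    simp only [Set.mem_prod, SetLike.mem_coe]
    split_ifs at hp <;> tauto
  have hne (U : KSet d k) : (U.1 : Set (Fin d)).Nonempty := by
    rw [Finset.coe_nonempty, ← Finset.card_pos, U.2]
    exact hk
  simpa [Subtype.ext_iff] using
    (Set.prod_eq_prod_iff_of_nonempty ((hne S).prod (hne S'))).1 hprod

theorem range_bicluster_perm (μ : ℝ) (v : Fin d × Fin d → ℝ)
    (hv : v ∈ Set.range (bicluster d k μ)) :
    Set.range (fun (g : Equiv.Perm (Fin d) × Equiv.Perm (Fin d)) (p : Fin d × Fin d) =>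
      v (g.1 p.1, g.2 p.2)) = Set.range (bicluster d k μ) := by
  obtain ⟨j, rfl⟩ := hv
  refine Set.Subset.antisymm ?_ ?_
  · rintro _ ⟨g, rfl⟩
    exact ⟨(ksetPerm g.1.symm j.1, ksetPerm g.2.symm j.2), bicluster_ksetPerm μ _ _ j⟩
  · rintro _ ⟨⟨T, T'⟩, rfl⟩
    obtain ⟨g, rfl⟩ := exists_ksetPerm_eq j.1 T
    obtain ⟨g', rfl⟩ := exists_ksetPerm_eq j.2 T'
    exact ⟨(g.symm, g'.symm), (bicluster_ksetPerm μ g g' j).symm⟩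

theorem maxRisk_bicluster_eq_minimaxRisk (hkd : k ≤ d) (hμ : μ ≠ 0)
    {T : (Fin d × Fin d → ℝ) → KSet d k × KSet d k} (hT : IsMLE (bicluster d k μ) T) :
    maxRisk (isotropicLaw (bicluster d k μ)) T =
      minimaxRisk (isotropicLaw (bicluster d k μ)) := by
  have := nonempty_kset hkd
  refine hT.maxRisk_eq_minimaxRisk (bicluster_injective hμ) fun j₁ j₂ => ?_
  obtain ⟨g, hg⟩ := exists_ksetPerm_eq j₁.1 j₂.1
  obtain ⟨g', hg'⟩ := exists_ksetPerm_eq j₁.2 j₂.2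
  exact ⟨Equiv.prodCongr g.symm g'.symm, Equiv.prodCongr (ksetPerm g) (ksetPerm g'),
    bicluster_ksetPerm μ g g', Prod.ext hg hg'⟩

end Symmetry

section BiclusterDistance

theorem weightedSqDist_ite_mem {ι : Type*} [Fintype ι] [DecidableEq ι] (B : ι → ℝ≥0) (μ : ℝ)
    (P Q : Finset ι) :
    weightedSqDist B (fun i => if i ∈ P then μ else 0) (fun i => if i ∈ Q then μ else 0) =
      μ ^ 2 * ∑ i ∈ symmDiff P Q, (B i : ℝ) := by
  rw [weightedSqDist, Finset.mul_sum, ← Finset.univ_inter (symmDiff P Q), ← Finset.sum_ite_mem]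
  refine Finset.sum_congr rfl fun i _ => ?_
  by_cases hP : i ∈ P <;> by_cases hQ : i ∈ Q <;> simp [Finset.mem_symmDiff, hP, hQ, mul_comm]

theorem bicluster_eq_ite_mem_product {d k : ℕ} (μ : ℝ) (j : KSet d k × KSet d k) :
    bicluster d k μ j = fun p => if p ∈ j.1.1 ×ˢ j.2.1 then μ else 0 := by
  ext p
  simp only [bicluster, Finset.mem_product]

theorem le_card_symmDiff_product {α β : Type*} [DecidableEq α] [DecidableEq β]
    (S T : Finset α) (S' T' : Finset β) :
    (S \ T).card * S'.card + T.card * (T' \ S').card ≤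
      (symmDiff (S ×ˢ S') (T ×ˢ T')).card := by
  have hdisj : Disjoint ((S \ T) ×ˢ S') (T ×ˢ (T' \ S')) :=
    Finset.disjoint_product.2 (Or.inl Finset.sdiff_disjoint)
  rw [← Finset.card_product, ← Finset.card_product, ← Finset.card_union_of_disjoint hdisj]
  refine Finset.card_le_card fun p hp => ?_
  simp only [Finset.mem_union, Finset.mem_product, Finset.mem_sdiff, Finset.mem_symmDiff] at hp ⊢
  tauto

theorem le_weightedSqDist_bicluster {d k : ℕ} (β : ℝ≥0) (μ : ℝ) (j j' : KSet d k × KSet d k) :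
    μ ^ 2 * β * k * ((j.1.1 \ j'.1.1).card + (j.2.1 \ j'.2.1).card : ℕ) ≤
      weightedSqDist (fun _ => β) (bicluster d k μ j') (bicluster d k μ j) := by
  have hcard : k * ((j.1.1 \ j'.1.1).card + (j.2.1 \ j'.2.1).card) ≤
      (symmDiff (j'.1.1 ×ˢ j'.2.1) (j.1.1 ×ˢ j.2.1)).card := by
    have := le_card_symmDiff_product j'.1.1 j.1.1 j'.2.1 j.2.1
    rwa [j'.2.2, j.1.2, Finset.card_sdiff_comm (j'.1.2.trans j.1.2.symm), mul_comm _ k,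
      ← mul_add] at this
  calc μ ^ 2 * β * k * ((j.1.1 \ j'.1.1).card + (j.2.1 \ j'.2.1).card : ℕ)
      = μ ^ 2 * β * (k * ((j.1.1 \ j'.1.1).card + (j.2.1 \ j'.2.1).card) : ℕ) := by
        push_cast
        ring
    _ ≤ μ ^ 2 * β * (symmDiff (j'.1.1 ×ˢ j'.2.1) (j.1.1 ×ˢ j.2.1)).card := by gcongr
    _ = weightedSqDist (fun _ => β) (bicluster d k μ j') (bicluster d k μ j) := by
        rw [bicluster_eq_ite_mem_product, bicluster_eq_ite_mem_product, weightedSqDist_ite_mem,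
          Finset.sum_const, nsmul_eq_mul]
        ring

end BiclusterDistance

section UpperBound

theorem productGaussian_setOf_logLikelihoodRatio_nonneg_le {ι : Type*} [Fintype ι]
    (B : ι → ℝ≥0) (u w : ι → ℝ) :
    productGaussian B w {y | 0 ≤ logLikelihoodRatio B u w y} ≤
      ENNReal.ofReal (Real.exp (-(weightedSqDist B u w / 8))) := by
  calc productGaussian B w {y | 0 ≤ logLikelihoodRatio B u w y}
      ≤ productGaussian B w
          {y | 1 ≤ ENNReal.ofReal (Real.exp (1 / 2 * logLikelihoodRatio B u w y))} := by
        refine measure_mono fun y (hy : 0 ≤ logLikelihoodRatio B u w y) => ?_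
        rw [Set.mem_ofPred_eq, ENNReal.one_le_ofReal, Real.one_le_exp_iff]
        positivity
    _ ≤ ∫⁻ y, ENNReal.ofReal (Real.exp (1 / 2 * logLikelihoodRatio B u w y))
          ∂productGaussian B w := by
        simpa using mul_meas_ge_le_lintegral (μ := productGaussian B w)
          (f := fun y => ENNReal.ofReal (Real.exp (1 / 2 * logLikelihoodRatio B u w y)))
          (by fun_prop) 1
    _ = ENNReal.ofReal (Real.exp (-(weightedSqDist B u w / 8))) := by
        rw [lintegral_exp_mul_logLikelihoodRatio]
        ring_nf

theorem minimaxRisk_designLaw_le {ι J : Type*} [Fintype ι] [Fintype J] [Nonempty J]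
    [DecidableEq J] (v : J → ι → ℝ) (B : ι → ℝ≥0) :
    minimaxRisk (designLaw v B) ≤ ⨆ j, ∑ j' ∈ Finset.univ.erase j,
      ENNReal.ofReal (Real.exp (-(weightedSqDist B (v j') (v j) / 8))) := by
  obtain ⟨T, hT, hmax⟩ := exists_measurable_argmax fun j =>
    measurable_logLikelihoodRatio B (v j) 0
  refine (minimaxRisk_le_maxRisk _ hT).trans (iSup_mono fun j => ?_)
  calc designLaw v B j {y | T y ≠ j}
      ≤ designLaw v B j (⋃ j' ∈ Finset.univ.erase j,
          {y | 0 ≤ logLikelihoodRatio B (v j') (v j) y}) := by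
        refine measure_mono fun y (hy : T y ≠ j) =>
          Set.mem_iUnion₂.2 ⟨T y, Finset.mem_erase.2 ⟨hy, Finset.mem_univ _⟩, ?_⟩
        have := hmax y j
        rwa [← sub_nonneg, logLikelihoodRatio_sub_logLikelihoodRatio] at this
    _ ≤ _ := (measure_biUnion_finset_le _ _).trans <| Finset.sum_le_sum fun j' _ => by
        rw [designLaw_eq_productGaussian]
        exact productGaussian_setOf_logLikelihoodRatio_nonneg_le B (v j') (v j)

theorem card_filter_sdiff_eq_le {d k : ℕ} (S : KSet d k) (A : Finset (Fin d)) :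
    (Finset.univ.filter fun T : KSet d k => S.1 \ T.1 = A).card ≤ (d - k) ^ A.card := by
  have hcompl : S.1ᶜ.card = d - k := by rw [Finset.card_compl, S.2, Fintype.card_fin]
  calc (Finset.univ.filter fun T : KSet d k => S.1 \ T.1 = A).card
      ≤ (Finset.powersetCard A.card S.1ᶜ).card := by
        refine Finset.card_le_card_of_injOn (fun T => T.1 \ S.1) (fun T hT => ?_) ?_
        · rw [Finset.mem_coe, Finset.mem_filter] at hT
          refine Finset.mem_powersetCard.2 ⟨fun a ha => ?_, ?_⟩
          · simpa using (Finset.mem_sdiff.1 ha).2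
          · rw [← hT.2, Finset.card_sdiff_comm (T.2.trans S.2.symm)]
        · intro T hT T' hT' h
          rw [Finset.mem_coe, Finset.mem_filter] at hT hT'
          have h₁ := Finset.ext_iff.1 (hT.2.trans hT'.2.symm)
          have h₂ := Finset.ext_iff.1 h
          simp only [Finset.mem_sdiff] at h₁ h₂
          ext a
          have := h₁ a
          have := h₂ a
          tauto
    _ ≤ (d - k) ^ A.card := by
        rw [Finset.card_powersetCard, hcompl]
        exact Nat.choose_le_pow _ _

theorem sum_kset_pow_card_sdiff_le {d k : ℕ} (S : KSet d k) {q : ℝ} (hq : 0 ≤ q) :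
    ∑ T : KSet d k, q ^ (S.1 \ T.1).card ≤ Real.exp (k * (d - k : ℕ) * q) := by
  calc ∑ T : KSet d k, q ^ (S.1 \ T.1).card
      = ∑ A ∈ S.1.powerset, ∑ T : KSet d k with S.1 \ T.1 = A, q ^ (S.1 \ T.1).card :=
        (Finset.sum_fiberwise_of_maps_to
          (fun T _ => Finset.mem_powerset.2 Finset.sdiff_subset) _).symm
    _ = ∑ A ∈ S.1.powerset,
          ((Finset.univ.filter fun T : KSet d k => S.1 \ T.1 = A).card : ℝ) * q ^ A.card := by
        refine Finset.sum_congr rfl fun A _ => ?_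
        rw [← nsmul_eq_mul]
        exact Finset.sum_eq_card_nsmul fun T hT => by rw [(Finset.mem_filter.1 hT).2]
    _ ≤ ∑ A ∈ S.1.powerset, ((d - k : ℕ) * q) ^ A.card * 1 ^ (S.1.card - A.card) := by
        refine Finset.sum_le_sum fun A _ => ?_
        rw [one_pow, mul_one, mul_pow]
        gcongr
        exact_mod_cast card_filter_sdiff_eq_le S A
    _ = ((d - k : ℕ) * q + 1) ^ k := by rw [Finset.sum_pow_mul_eq_add_pow, S.2]
    _ ≤ Real.exp ((d - k : ℕ) * q) ^ k := by
        gcongr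
        exact Real.add_one_le_exp _
    _ = Real.exp (k * (d - k : ℕ) * q) := by rw [← Real.exp_nat_mul, mul_assoc]

theorem minimaxRisk_bicluster_le {d k : ℕ} (hkd : k ≤ d) (μ : ℝ) (β : ℝ≥0) :
    minimaxRisk (designLaw (bicluster d k μ) fun _ => β) ≤ ENNReal.ofReal
      (Real.exp (2 * (k * (d - k : ℕ) * Real.exp (-(μ ^ 2 * β * k / 8)))) - 1) := by
  have := nonempty_kset hkd
  set q := Real.exp (-(μ ^ 2 * β * k / 8)) with hq
  have hq0 : 0 ≤ q := (Real.exp_pos _).le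
  refine (minimaxRisk_designLaw_le _ _).trans (iSup_le fun j => ?_)
  let r : KSet d k × KSet d k → ℝ := fun j' =>
    q ^ ((j.1.1 \ j'.1.1).card + (j.2.1 \ j'.2.1).card)
  have hdist (j' : KSet d k × KSet d k) : Real.exp
      (-(weightedSqDist (fun _ => β) (bicluster d k μ j') (bicluster d k μ j) / 8)) ≤ r j' := by
    rw [show r j' = _ from (Real.exp_nat_mul _ _).symm, Real.exp_le_exp]
    linarith [le_weightedSqDist_bicluster β μ j j']
  have hsum : ∑ j', r j' ≤ Real.exp (2 * (k * (d - k : ℕ) * q)) := by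
    simp only [r, pow_add, Fintype.sum_prod_type]
    rw [← Finset.sum_mul_sum, two_mul, Real.exp_add]
    gcongr <;> exact sum_kset_pow_card_sdiff_le _ hq0
  have hj : r j = 1 := by simp [r]
  rw [← ENNReal.ofReal_sum_of_nonneg fun _ _ => (Real.exp_pos _).le]
  refine ENNReal.ofReal_le_ofReal ((Finset.sum_le_sum fun j' _ => hdist j').trans ?_)
  rw [← Finset.add_sum_erase _ _ (Finset.mem_univ j), hj] at hsum
  linarith

end UpperBound

section LowerBound

theorem one_sub_le_minimaxRisk_designLaw {ι J A : Type*} [Fintype ι] [Fintype A] [Nonempty A]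
    (v : J → ι → ℝ) (B : ι → ℝ≥0) (w : ι → ℝ) {F : A → J} (hF : F.Injective) {D : ℝ}
    (hD : ∀ a, weightedSqDist B (v (F a)) w ≤ D) :
    ENNReal.ofReal (1 - Real.exp (D / 2) / √(Fintype.card A)) ≤ minimaxRisk (designLaw v B) := by
  have hA : (0 : ℝ) < Fintype.card A := by exact_mod_cast Fintype.card_pos
  rw [ENNReal.ofReal_sub 1 (by positivity), ENNReal.ofReal_one]
  refine le_trans ?_ (minimaxRisk_comp_le hF _)
  refine one_sub_le_minimaxRisk_of_lintegral_sq_le (Q := productGaussian B w)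
    (f := fun a y => ENNReal.ofReal (Real.exp (logLikelihoodRatio B (v (F a)) w y)))
    (fun a => by fun_prop) (fun a => productGaussian_eq_withDensity B (v (F a)) w) fun a => ?_
  calc ∫⁻ y, ENNReal.ofReal (Real.exp (logLikelihoodRatio B (v (F a)) w y)) ^ 2
        ∂productGaussian B w
      = ∫⁻ y, ENNReal.ofReal (Real.exp (2 * logLikelihoodRatio B (v (F a)) w y))
          ∂productGaussian B w := by
        refine lintegral_congr fun y => ?_
        rw [← ENNReal.ofReal_pow (Real.exp_pos _).le, ← Real.exp_nat_mul, Nat.cast_two]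
    _ = ENNReal.ofReal (Real.exp (weightedSqDist B (v (F a)) w)) := by
        rw [lintegral_exp_mul_logLikelihoodRatio]
        ring_nf
    _ ≤ ENNReal.ofReal (Real.exp D) := by
        gcongr
        exact hD a
    _ = Fintype.card A * ENNReal.ofReal (Real.exp (D / 2) / √(Fintype.card A)) ^ 2 := by
        rw [← ENNReal.ofReal_pow (by positivity), ← ENNReal.ofReal_natCast,
          ← ENNReal.ofReal_mul hA.le, div_pow, Real.sq_sqrt hA.le, mul_div_cancel₀ _ hA.ne',
          ← Real.exp_nat_mul, Nat.cast_two, mul_div_cancel₀ _ two_ne_zero]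

variable {d k : ℕ}

theorem exists_kset_mul_sum_le [NeZero d] (hk : k ≤ d) (c : Fin d → ℝ) :
    ∃ S : KSet d k, d * ∑ b ∈ S.1, c b ≤ k * ∑ b, c b := by
  obtain ⟨S₀⟩ := nonempty_kset hk
  -- Averaged over all cyclic shifts of `S₀`, the inequality is an equality.
  have hshift (r : Fin d) :
      ∑ b ∈ (ksetPerm (Equiv.addRight r) S₀).1, c b = ∑ b ∈ S₀.1, c (b + r) := by
    simp [ksetPerm]
  have haverage : ∑ r : Fin d, (d : ℝ) * ∑ b ∈ (ksetPerm (Equiv.addRight r) S₀).1, c b =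
      ∑ _r : Fin d, (k : ℝ) * ∑ b, c b := by
    have hb (b : Fin d) : ∑ r, c (b + r) = ∑ r, c r := Equiv.sum_comp (Equiv.addLeft b) c
    simp_rw [hshift]
    rw [← Finset.mul_sum, Finset.sum_comm]
    simp [hb, S₀.2]
  obtain ⟨r, -, hr⟩ := Finset.exists_le_of_sum_le Finset.univ_nonempty haverage.le
  exact ⟨_, hr⟩

theorem mul_card_filter_lt_le {ι : Type*} [Fintype ι] {r : ι → ℝ} (hr : ∀ a, 0 ≤ r a) {s : ℝ}
    (hs : 0 < s) (hsum : ∑ a, r a ≤ Fintype.card ι * s) (c : ℝ) :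
    c * (Finset.univ.filter fun a => c * s < r a).card ≤ Fintype.card ι := by
  refine le_of_mul_le_mul_right ?_ hs
  calc c * (Finset.univ.filter fun a => c * s < r a).card * s
      = ∑ a with c * s < r a, c * s := by rw [Finset.sum_const, nsmul_eq_mul]; ring
    _ ≤ ∑ a with c * s < r a, r a :=
        Finset.sum_le_sum fun a ha => (Finset.mem_filter.1 ha).2.le
    _ ≤ ∑ a, r a :=
        Finset.sum_le_sum_of_subset_of_nonneg (Finset.filter_subset _ _) fun a _ _ => hr a
    _ ≤ Fintype.card ι * s := hsum

theorem exists_light_columns_and_rows (hk : 1 ≤ k) (hkd : k ≤ d) {B : Fin d × Fin d → ℝ≥0} {β : ℝ}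
    (hβ : 0 < β) (hB : ∑ p, (B p : ℝ) ≤ d ^ 2 * β) :
    ∃ (S' : KSet d k) (U : Finset (Fin d)),
      4 * Uᶜ.card ≤ d ∧ ∀ a ∈ U, ∑ b ∈ S'.1, (B (a, b) : ℝ) ≤ 4 * (k * β) := by
  have : NeZero d := ⟨by omega⟩
  have hd : (0 : ℝ) < d := by exact_mod_cast (by omega : 0 < d)
  have : (0 : ℝ) < k := by exact_mod_cast hk
  obtain ⟨S', hS'⟩ := exists_kset_mul_sum_le hkd fun b => ∑ a, (B (a, b) : ℝ)
  have hrows : ∑ a, ∑ b ∈ S'.1, (B (a, b) : ℝ) ≤ Fintype.card (Fin d) * (k * β) := by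
    rw [Finset.sum_comm, Fintype.card_fin]
    refine le_of_mul_le_mul_left (hS'.trans ?_) hd
    rw [← Fintype.sum_prod_type_right']
    calc (k : ℝ) * ∑ p, (B p : ℝ) ≤ k * (d ^ 2 * β) := by gcongr
      _ = d * (d * (k * β)) := by ring
  refine ⟨S', Finset.univ.filter fun a => ∑ b ∈ S'.1, (B (a, b) : ℝ) ≤ 4 * (k * β), ?_,
    fun a ha => (Finset.mem_filter.1 ha).2⟩
  have := mul_card_filter_lt_le (fun a => Finset.sum_nonneg fun b _ => (B (a, b)).coe_nonneg)
    (by positivity) hrows 4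
  simp only [Finset.compl_filter, not_le]
  rw [Fintype.card_fin] at this
  exact_mod_cast this

theorem exists_symmDiff_singleton_card (hk : 1 ≤ k) (hkd : k < d) {U : Finset (Fin d)}
    (hU : 4 * Uᶜ.card ≤ d) :
    ∃ S₀ : Finset (Fin d), ∃ I ⊆ U, d ≤ 4 * I.card ∧ ∀ a ∈ I, (symmDiff S₀ {a}).card = k := by
  have hcard : U.card + Uᶜ.card = d := by simp
  -- The element `a` is added to `S₀` if `2 * k ≤ d` and removed from it otherwise: either way a
  -- constant fraction of all elements is available.
  rcases le_or_gt (2 * k) d with h | h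
  · obtain ⟨S₀⟩ := nonempty_kset (d := d) (k := k - 1) (by omega)
    refine ⟨S₀.1, U \ S₀.1, Finset.sdiff_subset, ?_, fun a ha => ?_⟩
    · have := Finset.le_card_sdiff S₀.1 U
      have := S₀.2
      omega
    · have ha' := Finset.disjoint_singleton_right.2 (Finset.mem_sdiff.1 ha).2
      rw [ha'.symmDiff_eq_sup, Finset.sup_eq_union, Finset.card_union_of_disjoint ha', S₀.2,
        Finset.card_singleton]
      omega
  · obtain ⟨S₀⟩ := nonempty_kset (d := d) (k := k + 1) (by omega)
    refine ⟨S₀.1, U ∩ S₀.1, Finset.inter_subset_left, ?_, fun a ha => ?_⟩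
    · have h₁ := Finset.card_union_add_card_inter U S₀.1
      have h₂ : (U ∪ S₀.1).card ≤ d := by simpa using (U ∪ S₀.1).card_le_univ
      have := S₀.2
      omega
    · have ha' : {a} ⊆ S₀.1 := Finset.singleton_subset_iff.2 (Finset.mem_inter.1 ha).2
      rw [symmDiff_of_ge ha', Finset.card_sdiff_of_subset ha', S₀.2, Finset.card_singleton]
      omega

theorem symmDiff_symmDiff_product {α β : Type*} [DecidableEq α] [DecidableEq β]
    (S A : Finset α) (S' : Finset β) :
    symmDiff (symmDiff S A ×ˢ S') (S ×ˢ S') = A ×ˢ S' := by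
  ext p
  simp only [Finset.mem_symmDiff, Finset.mem_product]
  tauto

theorem one_sub_le_minimaxRisk_bicluster (hk : 1 ≤ k) (hkd : k < d) (μ : ℝ)
    {B : Fin d × Fin d → ℝ≥0} {β : ℝ} (hβ : 0 < β) (hB : ∑ p, (B p : ℝ) ≤ d ^ 2 * β) :
    ENNReal.ofReal (1 - 2 * Real.exp (2 * (μ ^ 2 * β * k)) / √d) ≤
      minimaxRisk (designLaw (bicluster d k μ) B) := by
  obtain ⟨S', U, hU, hlight⟩ := exists_light_columns_and_rows hk hkd.le hβ hB
  obtain ⟨S₀, I, hIU, hI, hcard⟩ := exists_symmDiff_singleton_card hk hkd hU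
  have : Nonempty I := (Finset.card_pos.1 (by omega)).to_subtype
  let F : I → KSet d k × KSet d k := fun a => (⟨symmDiff S₀ {a.1}, hcard a.1 a.2⟩, S')
  have hF : F.Injective := fun a a' h => Subtype.ext <| Finset.singleton_injective <|
    symmDiff_right_injective S₀ (congrArg (fun j => j.1.1) h)
  have hdist (a : I) : weightedSqDist B (bicluster d k μ (F a))
      (fun p => if p ∈ S₀ ×ˢ S'.1 then μ else 0) ≤ μ ^ 2 * (4 * (k * β)) := by
    rw [bicluster_eq_ite_mem_product, weightedSqDist_ite_mem, symmDiff_symmDiff_product,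
      Finset.sum_product, Finset.sum_singleton]
    gcongr
    exact hlight a (hIU a.2)
  refine (ENNReal.ofReal_le_ofReal ?_).trans (one_sub_le_minimaxRisk_designLaw _ B _ hF hdist)
  have hsqrt : √d ≤ 2 * √(Fintype.card I) := by
    refine Real.sqrt_le_iff.2 ⟨by positivity, ?_⟩
    rw [mul_pow, Real.sq_sqrt (Nat.cast_nonneg _), Fintype.card_coe]
    exact_mod_cast (by omega : d ≤ 2 ^ 2 * I.card)
  have hd : 0 < √(d : ℝ) := Real.sqrt_pos.2 (by exact_mod_cast (by omega : 0 < d))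
  rw [show μ ^ 2 * (4 * (k * β)) / 2 = 2 * (μ ^ 2 * β * k) by ring,
    ← mul_div_mul_left _ (√(Fintype.card I : ℝ)) (two_ne_zero' ℝ)]
  gcongr

end LowerBound

section Rates

section Limits

variable {L a μ : ℕ → ℝ} {R : ℕ → ℝ≥0∞}

theorem tendsto_zero_of_sqrt_div_isLittleO (hL : Tendsto L atTop atTop) (ha : ∀ n, 0 < a n)
    (hR : ∀ n, R n ≤ ENNReal.ofReal (Real.exp (2 * Real.exp (L n - a n * μ n ^ 2 / 8)) - 1))
    (h : (fun n => √(L n / a n)) =o[atTop] μ) : Tendsto R atTop (𝓝 0) := by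
  have hlim : Tendsto (fun n => ENNReal.ofReal (Real.exp (2 * Real.exp (-L n)) - 1))
      atTop (𝓝 0) := by
    have := (Real.tendsto_exp_neg_atTop_nhds_zero.comp hL).const_mul 2
    simpa using ENNReal.tendsto_ofReal (((Real.continuous_exp.tendsto _).comp this).sub_const 1)
  refine tendsto_of_tendsto_of_tendsto_of_le_of_le' tendsto_const_nhds hlim
    (Eventually.of_forall fun _ => zero_le) ?_
  filter_upwards [h.def (show (0 : ℝ) < 1 / 4 by norm_num)] with n hn
  have hsignal : 16 * L n ≤ a n * μ n ^ 2 := by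
    rw [Real.norm_of_nonneg (Real.sqrt_nonneg _), Real.sqrt_le_iff, mul_pow, Real.norm_eq_abs,
      sq_abs, div_le_iff₀ (ha n)] at hn
    linarith [hn.2]
  refine (hR n).trans ?_
  gcongr
  linarith

theorem tendsto_one_of_isLittleO_sqrt_div (hL : Tendsto L atTop atTop) (ha : ∀ n, 0 < a n)
    (hone : ∀ n, R n ≤ 1)
    (hR : ∀ n, ENNReal.ofReal (1 - 2 * Real.exp (2 * (a n * μ n ^ 2) - L n / 4)) ≤ R n)
    (h : μ =o[atTop] fun n => √(L n / a n)) : Tendsto R atTop (𝓝 1) := by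
  have hlim : Tendsto (fun n => ENNReal.ofReal (1 - 2 * Real.exp (-(L n / 8)))) atTop (𝓝 1) := by
    have := (Real.tendsto_exp_neg_atTop_nhds_zero.comp
      (hL.atTop_div_const (show (0 : ℝ) < 8 by norm_num))).const_mul 2
    simpa using ENNReal.tendsto_ofReal (this.const_sub 1)
  refine tendsto_of_tendsto_of_tendsto_of_le_of_le' hlim tendsto_const_nhds ?_
    (Eventually.of_forall hone)
  filter_upwards [h.def (show (0 : ℝ) < 1 / 4 by norm_num), hL.eventually_ge_atTop 0] with n hn hLn
  have hsignal : 16 * (a n * μ n ^ 2) ≤ L n := by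
    have hsq := pow_le_pow_left₀ (norm_nonneg _) hn 2
    rw [mul_pow, Real.norm_eq_abs, Real.norm_eq_abs, sq_abs, sq_abs,
      Real.sq_sqrt (div_nonneg hLn (ha n).le), ← mul_div_assoc, le_div_iff₀ (ha n)] at hsq
    linarith
  refine le_trans ?_ (hR n)
  gcongr
  linarith

end Limits

theorem designMinimaxRisk_le_minimaxRisk_const {ι J : Type*} [Fintype ι] (v : J → ι → ℝ)
    (β : ℝ≥0) :
    designMinimaxRisk v (Fintype.card ι * β) ≤ minimaxRisk (designLaw v fun _ => β) :=
  iInf₂_le _ (by rw [Finset.sum_const, Finset.card_univ, nsmul_eq_mul])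

section Bicluster

variable {d k : ℕ}

theorem mul_sub_pos (hk : 1 ≤ k) (hkd : k < d) : (0 : ℝ) < k * (d - k) :=
  mul_pos (by exact_mod_cast hk) (sub_pos.2 (by exact_mod_cast hkd))

theorem log_mul_sub_le (hk : 1 ≤ k) (hkd : k < d) :
    Real.log (k * (d - k)) ≤ 2 * Real.log d := by
  rw [← Nat.cast_two, ← Real.log_pow, sq]
  have hd : (k : ℝ) ≤ d := by exact_mod_cast hkd.le
  refine Real.log_le_log (mul_sub_pos hk hkd) (mul_le_mul hd ?_ ?_ (Nat.cast_nonneg _))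
  · exact sub_le_self _ (Nat.cast_nonneg _)
  · exact sub_nonneg.2 hd

theorem minimaxRisk_bicluster_le_exp_log (hk : 1 ≤ k) (hkd : k < d) (μ : ℝ) (β : ℝ≥0) :
    minimaxRisk (designLaw (bicluster d k μ) fun _ => β) ≤ ENNReal.ofReal
      (Real.exp (2 * Real.exp (Real.log (k * (d - k)) - β * k * μ ^ 2 / 8)) - 1) := by
  refine (minimaxRisk_bicluster_le hkd.le μ β).trans_eq ?_
  rw [sub_eq_add_neg (Real.log _), Real.exp_add, Real.exp_log (mul_sub_pos hk hkd),
    Nat.cast_sub hkd.le]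
  ring_nf

theorem one_sub_exp_log_le_designMinimaxRisk_bicluster (hk : 1 ≤ k) (hkd : k < d) (μ : ℝ) {β : ℝ}
    (hβ : 0 < β) :
    ENNReal.ofReal (1 - 2 * Real.exp (2 * (β * k * μ ^ 2) - Real.log (k * (d - k)) / 4)) ≤
      designMinimaxRisk (bicluster d k μ) (d ^ 2 * β) := by
  refine le_iInf₂ fun B hB =>
    (ENNReal.ofReal_le_ofReal ?_).trans (one_sub_le_minimaxRisk_bicluster hk hkd μ hβ hB)
  have hd : (0 : ℝ) < √d := Real.sqrt_pos.2 (by exact_mod_cast (by omega : 0 < d))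
  have hlog := log_mul_sub_le hk hkd
  have hsqrt : Real.exp (Real.log (k * (d - k)) / 4) ≤ √d := by
    rw [← Real.le_log_iff_exp_le hd, Real.log_sqrt (Nat.cast_nonneg _)]
    linarith
  rw [Real.exp_sub, ← mul_div_assoc, show β * k * μ ^ 2 = μ ^ 2 * β * k by ring]
  gcongr

end Bicluster

variable {d k : ℕ → ℕ}

theorem tendsto_log_mul_sub_atTop (hk : ∀ n, 1 ≤ k n) (hkd : ∀ n, k n < d n)
    (hd : Tendsto d atTop atTop) :
    Tendsto (fun n => Real.log (k n * ((d n : ℝ) - k n))) atTop atTop := by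
  refine Real.tendsto_log_atTop.comp (tendsto_atTop_mono (fun n => ?_)
    (tendsto_atTop_add_const_right _ (-1) (tendsto_natCast_atTop_atTop.comp hd)))
  have hk₁ : (1 : ℝ) ≤ k n := by exact_mod_cast hk n
  have hkd₁ : (k n : ℝ) + 1 ≤ d n := by exact_mod_cast hkd n
  change (d n : ℝ) + -1 ≤ k n * ((d n : ℝ) - k n)
  nlinarith

theorem isMinimaxRate_bicluster (hk : ∀ n, 1 ≤ k n) (hkd : ∀ n, k n < d n)
    (hd : Tendsto d atTop atTop) {β : ℕ → ℝ≥0} (hβ : ∀ n, 0 < β n) {R : ℕ → ℝ → ℝ≥0∞}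
    (hlower : ∀ n μ, designMinimaxRisk (bicluster (d n) (k n) μ) (d n ^ 2 * β n) ≤ R n μ)
    (hupper : ∀ n μ, R n μ ≤ minimaxRisk (designLaw (bicluster (d n) (k n) μ) fun _ => β n)) :
    IsMinimaxRate R fun n => √(Real.log (k n * ((d n : ℝ) - k n)) / (β n * k n)) := by
  have hL := tendsto_log_mul_sub_atTop hk hkd hd
  have ha (n : ℕ) : (0 : ℝ) < β n * k n := by
    have := hk n
    have := hβ n
    positivity
  intro μ _
  refine ⟨tendsto_zero_of_sqrt_div_isLittleO hL ha fun n => ?_,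
    tendsto_one_of_isLittleO_sqrt_div hL ha (fun n => ?_) fun n => ?_⟩
  · exact (hupper n _).trans (minimaxRisk_bicluster_le_exp_log (hk n) (hkd n) _ _)
  · have := nonempty_kset (hkd n).le
    exact (hupper n _).trans (minimaxRisk_le_one _)
  · have hβn : (0 : ℝ) < β n := by exact_mod_cast hβ n
    exact (one_sub_exp_log_le_designMinimaxRisk_bicluster (hk n) (hkd n) _ hβn).trans (hlower n _)

theorem designMinimaxRisk_bicluster_le_minimaxRisk_const (d k : ℕ) (μ : ℝ) (β : ℝ≥0) :
    designMinimaxRisk (bicluster d k μ) (d ^ 2 * β) ≤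
      minimaxRisk (designLaw (bicluster d k μ) fun _ => β) := by
  simpa [sq] using designMinimaxRisk_le_minimaxRisk_const (bicluster d k μ) β

theorem isMinimaxRate_isotropic_bicluster (hk : ∀ n, 1 ≤ k n) (hkd : ∀ n, k n < d n)
    (hd : Tendsto d atTop atTop) :
    IsMinimaxRate (fun n μ => minimaxRisk (isotropicLaw (bicluster (d n) (k n) μ)))
      (fun n => √(Real.log ((k n : ℝ) * ((d n : ℝ) - (k n : ℝ))) / (k n : ℝ))) := by
  simp_rw [isotropicLaw_eq_designLaw]
  simpa using isMinimaxRate_bicluster hk hkd hd (β := fun _ => 1) (fun _ => one_pos)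
    (fun n μ => designMinimaxRisk_bicluster_le_minimaxRisk_const (d n) (k n) μ 1)
    (fun _ _ => le_rfl)

theorem isMinimaxRate_design_bicluster (hk : ∀ n, 1 ≤ k n) (hkd : ∀ n, k n < d n)
    (hd : Tendsto d atTop atTop) {τ : ℕ → ℝ} (hτ : ∀ n, 0 < τ n) :
    IsMinimaxRate (fun n μ => designMinimaxRisk (bicluster (d n) (k n) μ) (τ n))
      (fun n => √((d n : ℝ) ^ 2 / (τ n * (k n : ℝ)) *
        Real.log ((k n : ℝ) * ((d n : ℝ) - (k n : ℝ))))) := by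
  have hd₀ (n : ℕ) : (0 : ℝ) < d n := by exact_mod_cast (Nat.zero_le _).trans_lt (hkd n)
  let β (n : ℕ) : ℝ≥0 := ⟨τ n / d n ^ 2, (div_pos (hτ n) (pow_pos (hd₀ n) 2)).le⟩
  have hβ (n : ℕ) : 0 < β n := div_pos (hτ n) (pow_pos (hd₀ n) 2)
  have hτβ (n : ℕ) : τ n = d n ^ 2 * β n := (mul_div_cancel₀ _ (pow_pos (hd₀ n) 2).ne').symm
  convert isMinimaxRate_bicluster hk hkd hd hβ (fun n μ => (hτβ n ▸ le_rfl))
    (fun n μ => hτβ n ▸ designMinimaxRisk_bicluster_le_minimaxRisk_const (d n) (k n) μ (β n))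
    using 3 with n
  rw [hτβ n, mul_assoc, ← div_div, div_self (pow_pos (hd₀ n) 2).ne', one_div, inv_mul_eq_div]

end Rates

end NormalMeans

open NormalMeans in
theorem corollary2 :
    -- minimax rates, along any sequence of problems with `1 ≤ k < d` and `d → ∞`
    (∀ d k : ℕ → ℕ, (∀ n, 1 ≤ k n) → (∀ n, k n < d n) → Tendsto d atTop atTop →
      IsMinimaxRate (fun n μ => minimaxRisk (isotropicLaw (bicluster (d n) (k n) μ)))
        (fun n => √(Real.log ((k n : ℝ) * ((d n : ℝ) - (k n : ℝ))) / (k n : ℝ))) ∧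
      ∀ τ : ℕ → ℝ, (∀ n, 0 < τ n) →
        IsMinimaxRate (fun n μ => designMinimaxRisk (bicluster (d n) (k n) μ) (τ n))
          (fun n => √((d n : ℝ) ^ 2 / (τ n * (k n : ℝ)) *
            Real.log ((k n : ℝ) * ((d n : ℝ) - (k n : ℝ)))))) ∧
    -- invariance of the family, and exact minimax optimality of the MLE, for each fixed problem
    (∀ (d k : ℕ) (μ : ℝ), k ≤ d → 0 < μ →
      (∀ v ∈ Set.range (bicluster d k μ),
        Set.range (fun (g : Equiv.Perm (Fin d) × Equiv.Perm (Fin d)) (p : Fin d × Fin d) =>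
          v (g.1 p.1, g.2 p.2)) = Set.range (bicluster d k μ)) ∧
      (∃ T, IsMLE (bicluster d k μ) T) ∧
      ∀ T, IsMLE (bicluster d k μ) T →
        maxRisk (isotropicLaw (bicluster d k μ)) T =
          minimaxRisk (isotropicLaw (bicluster d k μ))) := by
  refine ⟨fun d k hk hkd hd => ⟨isMinimaxRate_isotropic_bicluster hk hkd hd,
    fun τ hτ => isMinimaxRate_design_bicluster hk hkd hd hτ⟩, fun d k μ hkd hμ => ?_⟩
  have := nonempty_kset hkd
  exact ⟨range_bicluster_perm μ, exists_isMLE _,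
    fun T hT => maxRisk_bicluster_eq_minimaxRisk hkd hμ.ne' hT⟩
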